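/- **Theorem.** A *polytope* in $\mathbb R^D$ is the convex hull of a finite set of points, and a *polyhedron* is the intersection of a finite set of closed halfspaces. The *faces* of a polytope or polyhedron $P$ are $\emptyset$, $P$ itself, and all sets $P\cap H$ where $H$ is a closed halfspace whose boundary hyperplane is disjoint from the relative interior of $P$. The dimension $\dim f$ of a nonempty face $f$ is the dimension of its affine hull, and $\dim\emptyset=-1$. For an affine-linear function $\ell:\mathbb R^D\to\mathbb R$ and a real number $B$, let $P^{\ell<B}$ be the set of faces $f$ of $P$ such that $\ell(p)<B$ for every $p\in f$; let $P^{\ell<\infty}$ be the set of faces of $P$ on which $\ell$ is bounded, both from above and from below. (The empty face always belongs to $P^{\ell<B}$.) Let $P$ be a polytope or polyhedron in $\mathbb R^D$, let $\ell$ be an affine-linear function, and let $B$ be a real number or $\infty$. Suppose that $P^{\ell<B}$ contains a nonempty face, and that every face in $P^{\ell<B}$ is bounded (which is automatic if $P$ is a polytope, and, for a polyhedron $P$, whenever the set of points where $\ell$ attains its minimum over $P$ is nonempty and bounded, for instance a single vertex). Then $P^{\ell<B}$ is finite and its Euler characteristic vanishes: $$\chi(P^{\ell<B})=\sum_{f\in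 P^{\ell<B}}(-1)^{\dim f}=0 .$$ -/

import Mathlib

namespace PolyEuler

noncomputable section

variable {E : Type*} [NormedAddCommGroup E] [NormedSpace ℝ E]

/-- A closed halfspace: `{x | a x ≤ b}` for a nonzero linear functional `a`. -/
def IsClosedHalfspace (H : Set E) : Prop :=
  ∃ a : E →L[ℝ] ℝ, a ≠ 0 ∧ ∃ b : ℝ, H = {x | a x ≤ b}

/-- A polytope: the convex hull of a finite set of points. -/
def IsPolytope (P : Set E) : Prop :=
  ∃ S : Set E, S.Finite ∧ P = convexHull ℝ S

/-- A polyhedron: the intersection of a finite set of closed halfspaces. -/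
def IsPolyhedron (P : Set E) : Prop :=
  ∃ T : Set (Set E), T.Finite ∧ (∀ H ∈ T, IsClosedHalfspace H) ∧ P = ⋂₀ T

/-- The faces of `P`: the empty set, `P` itself, and the sets `P ∩ H` with `H` a closed halfspace
whose boundary hyperplane is disjoint from the relative interior of `P`.  (The first two are
listed separately only for the sake of `P = E`, for which no suitable `H` exists.) -/
def IsFace (P f : Set E) : Prop :=
  f = ∅ ∨ f = P ∨
    ∃ a : E →L[ℝ] ℝ, a ≠ 0 ∧ ∃ b : ℝ,
      Disjoint {x | a x = b} (intrinsicInterior ℝ P) ∧ f = P ∩ {x | a x ≤ b}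

open Classical in
/-- The dimension of (the affine hull of) a face, with the convention `dim ∅ = -1`. -/
def faceDim (f : Set E) : ℤ :=
  if f = ∅ then -1 else (Module.finrank ℝ (affineSpan ℝ f).direction : ℤ)

/-- `P^{ℓ<B}`: for real `B`, the faces of `P` at every point of which `ℓ < B`;
for `B = ∞`, the faces of `P` on which `ℓ` is bounded, above and below. -/
def sublevelFaces (P : Set E) (ℓ : E →ᵃ[ℝ] ℝ) : WithTop ℝ → Set (Set E)
  | ⊤ => {f | IsFace P f ∧ BddAbove (ℓ '' f) ∧ BddBelow (ℓ '' f)}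
  | (B : ℝ) => {f | IsFace P f ∧ ∀ p ∈ f, ℓ p < B}

/-- The Euler characteristic `∑ (-1) ^ dim f` of a (finite) set of faces. -/
def eulerChar (C : Set (Set E)) : ℤ :=
  ∑ᶠ f ∈ C, (((-1 : ℤˣ) ^ faceDim f : ℤˣ) : ℤ)

end

end PolyEuler

open Set Filter Topology Module

namespace PolyEuler

universe u

variable {E : Type u} [NormedAddCommGroup E] [NormedSpace ℝ E]

/-! Give a nonempty compact convex set the weight 1 and a nonempty bounded relatively open convex
set of dimension d the weight (-1)^d. Every integer relation between indicators of such sets also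
holds between their weights (`HasEuler.unique`). This follows by induction on dimension: the weight
of a piece is the sum over t of the jumps g t - g (t+0) of the weights of its slices
(`HasEuler.slice`), and the slices of a vanishing combination vanish.

Now choose a linear `m` and a real `c` such that Q = P ∩ {m ≤ c} is compact and the faces to be
counted are those on which m ≤ c. The relative interiors of the nonempty faces partition P, so the
weight 1 of Q is the sum of the weights of relint f ∩ {m ≤ c}. Such a term is (-1)^dim f if f lies
in the halfspace. Otherwise it is empty, or it splits into the part m < c and the slice m = c, of
dimension one less, and these cancel. The counted nonempty faces thus sum to 1, and the empty face
contributes -1.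

Boundedness of Q needs an argument only for polyhedra. For real B, `m` is the linear part of ℓ; a
pivoting argument (`le_of_forall_le_of_isExposed`) shows that `m` attains its minimum over P, on a
bounded face, so `m` is positive on nonzero recession directions. For B = ∞, `m` is minus the sum of
the constraint functionals; it is positive there because a bounded nonempty face excludes lines in
P. -/

/-- `HasEuler A F e`: the function `F` is an integer combination of indicators of nonempty convex
subsets of `A`, each compact (weight `1`) or bounded and relatively open of dimension `d`
(weight `(-1) ^ d`), and `e` is the corresponding combination of weights. -/
inductive HasEuler (A : Set E) : (E → ℤ) → ℤ → Prop
  | zero : HasEuler A 0 0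
  | compact {K : Set E} (hK : IsCompact K) (hc : Convex ℝ K) (hne : K.Nonempty) (hA : K ⊆ A) :
      HasEuler A (K.indicator 1) 1
  | relOpen {K U : Set E} {q : E} {W : Submodule ℝ E} (hU : IsOpen U)
      (hK : ∀ x, x ∈ K ↔ x ∈ U ∧ x - q ∈ W) (hq : q ∈ U) (hc : Convex ℝ K)
      (hb : Bornology.IsBounded K) (hA : K ⊆ A) :
      HasEuler A (K.indicator 1) ((-1) ^ finrank ℝ W)
  | add {F G : E → ℤ} {d e : ℤ} (hF : HasEuler A F d) (hG : HasEuler A G e) :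
      HasEuler A (F + G) (d + e)
  | neg {F : E → ℤ} {e : ℤ} (hF : HasEuler A F e) : HasEuler A (-F) (-e)

/-! ### Uniqueness of the Euler characteristic -/

namespace HasEuler

theorem sum {A : Set E} {ι : Type*} (s : Finset ι) {F : ι → E → ℤ} {e : ι → ℤ}
    (h : ∀ i ∈ s, HasEuler A (F i) (e i)) : HasEuler A (∑ i ∈ s, F i) (∑ i ∈ s, e i) := by
  classical
  induction s using Finset.induction_on with
  | empty => simpa using zero
  | insert i s hi ih =>
    rw [Finset.sum_insert hi, Finset.sum_insert hi]
    exact (h i (by simp)).add (ih fun j hj => h j (by simp [hj]))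

theorem eq_apply_of_subset_singleton {A : Set E} {p : E} (hA : A ⊆ {p}) {F : E → ℤ} {e : ℤ}
    (h : HasEuler A F e) : e = F p := by
  induction h with
  | zero => rfl
  | compact hK hc hne hKA =>
    obtain ⟨x, hx⟩ := hne
    obtain rfl : x = p := hA (hKA hx)
    simp [hx]
  | @relOpen K U q W hU hK hq hc hb hKA =>
    have hqK : q ∈ K := (hK q).2 ⟨hq, by simp⟩
    obtain rfl : q = p := hA (hKA hqK)
    -- A nonzero direction in `W` would move `q` inside `K` to a second point of `A`.
    have hW : W = ⊥ := by
      rw [Submodule.eq_bot_iff]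
      intro w hw
      have ht : Tendsto (fun t : ℝ => q + t • w) (𝓝[>] 0) (𝓝 q) := by
        have : Continuous fun t : ℝ => q + t • w := by fun_prop
        simpa using (this.tendsto 0).mono_left nhdsWithin_le_nhds
      obtain ⟨t, htU, ht0⟩ :=
        ((ht.eventually (hU.mem_nhds hq)).and self_mem_nhdsWithin).exists
      have hmem : q + t • w ∈ K := (hK _).2 ⟨htU, by simpa using W.smul_mem t hw⟩
      have : q + t • w = q := hA (hKA hmem)
      have h0 : t • w = 0 := by simpa using this
      exact (smul_eq_zero.1 h0).resolve_left (ne_of_gt ht0)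
    subst hW
    simp [hqK]
  | add _ _ h₁ h₂ => rw [h₁, h₂]; rfl
  | neg _ h => rw [h]; rfl


theorem eventually_add_mem_Icc_iff (a b t : ℝ) :
    ∀ᶠ ε in 𝓝[>] (0 : ℝ), t + ε ∈ Icc a b ↔ t ∈ Ico a b := by
  have hlim (c : ℝ) (h : t < c) : ∀ᶠ ε in 𝓝[>] (0 : ℝ), t + ε < c := by
    filter_upwards [Ioo_mem_nhdsGT (sub_pos.2 h)] with ε hε
    linarith [hε.2]
  rcases lt_or_ge t a with ha | ha
  · filter_upwards [hlim a ha] with ε hε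
    simp only [mem_Icc, mem_Ico]; constructor <;> rintro ⟨h, -⟩ <;> linarith
  rcases lt_or_ge t b with hb | hb
  · filter_upwards [hlim b hb, self_mem_nhdsWithin] with ε hε (hε0 : 0 < ε)
    simp only [mem_Icc, mem_Ico]; constructor <;> intro <;> constructor <;> linarith
  · filter_upwards [self_mem_nhdsWithin] with ε (hε0 : 0 < ε)
    simp only [mem_Icc, mem_Ico]; constructor <;> rintro ⟨-, h⟩ <;> linarith

theorem eventually_add_mem_Ioo_iff (a b t : ℝ) :
    ∀ᶠ ε in 𝓝[>] (0 : ℝ), t + ε ∈ Ioo a b ↔ t ∈ Ico a b := by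
  have hlim (c : ℝ) (h : t < c) : ∀ᶠ ε in 𝓝[>] (0 : ℝ), t + ε < c := by
    filter_upwards [Ioo_mem_nhdsGT (sub_pos.2 h)] with ε hε
    linarith [hε.2]
  rcases lt_or_ge t a with ha | ha
  · filter_upwards [hlim a ha] with ε hε
    simp only [mem_Ioo, mem_Ico]; constructor <;> rintro ⟨h, -⟩ <;> linarith
  rcases lt_or_ge t b with hb | hb
  · filter_upwards [hlim b hb, self_mem_nhdsWithin] with ε hε (hε0 : 0 < ε)
    simp only [mem_Ioo, mem_Ico]; constructor <;> intro <;> constructor <;> linarith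
  · filter_upwards [self_mem_nhdsWithin] with ε (hε0 : 0 < ε)
    simp only [mem_Ioo, mem_Ico]; constructor <;> rintro ⟨-, h⟩ <;> linarith

theorem finrank_inf_ker_add_one [FiniteDimensional ℝ E] {W : Submodule ℝ E} {ℓ : E →L[ℝ] ℝ}
    {w : E} (hw : w ∈ W) (hℓ : ℓ w ≠ 0) :
    finrank ℝ (W ⊓ LinearMap.ker (ℓ : E →ₗ[ℝ] ℝ) : Submodule ℝ E) + 1 = finrank ℝ W := by
  have h0 : (ℓ : E →ₗ[ℝ] ℝ).domRestrict W ≠ 0 := fun h =>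
    hℓ (by simpa using LinearMap.congr_fun h ⟨w, hw⟩)
  have hmap : W ⊓ LinearMap.ker (ℓ : E →ₗ[ℝ] ℝ) =
      (LinearMap.ker ((ℓ : E →ₗ[ℝ] ℝ).domRestrict W)).map W.subtype := by
    ext x; simp [and_comm]
  rw [← Module.Dual.finrank_ker_add_one_of_ne_zero h0, hmap,
    Submodule.finrank_map_subtype_eq]

theorem eq_Ioo_of_isOpen_convex {s : Set ℝ} (ho : IsOpen s) (hc : Convex ℝ s)
    (hb : Bornology.IsBounded s) (hne : s.Nonempty) : ∃ a b, a < b ∧ s = Ioo a b := by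
  have hsub : s ⊆ Ioo (sInf s) (sSup s) := fun x hx => by
    obtain ⟨l, u, hlu, hsubset⟩ := mem_nhds_iff_exists_Ioo_subset.1 (ho.mem_nhds hx)
    constructor
    · obtain ⟨y, hy⟩ := exists_between hlu.1
      exact (csInf_le hb.bddBelow (hsubset ⟨hy.1, hy.2.trans hlu.2⟩)).trans_lt hy.2
    · obtain ⟨y, hy⟩ := exists_between hlu.2
      exact hy.1.trans_le (le_csSup hb.bddAbove (hsubset ⟨hlu.1.trans hy.1, hy.2⟩))
  refine ⟨sInf s, sSup s, ?_, hsub.antisymm ?_⟩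
  · obtain ⟨x, hx⟩ := hne
    exact (hsub hx).1.trans (hsub hx).2
  · exact IsConnected.Ioo_csInf_csSup_subset ⟨hne, hc.isPreconnected⟩ hb.bddBelow hb.bddAbove

/-- A compact piece with image [a, b] has slices of weight 1 and its only jump, 1 - 0, at b. A
relatively open piece with image (a, b) has slices of weight (-1)^(d-1) and its only jump, 0 -
(-1)^(d-1) = (-1)^d, at a. If `ℓ` is constant on a relatively open piece, the one nonempty slice is
the piece itself. -/
theorem slice [FiniteDimensional ℝ E] {A : Set E} (ℓ : E →L[ℝ] ℝ) {F : E → ℤ} {e : ℤ}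
    (h : HasEuler A F e) :
    ∃ g : ℝ → ℤ, (∀ t, HasEuler (A ∩ {x | ℓ x = t}) ({x | ℓ x = t}.indicator F) (g t)) ∧
      ∃ j : ℝ →₀ ℤ, (j.sum fun _ n => n) = e ∧
        ∀ t, ∀ᶠ ε in 𝓝[>] (0 : ℝ), g t - g (t + ε) = j t := by
  classical
  induction h with
  | zero =>
    refine ⟨0, fun t => ?_, 0, by simp, by simp⟩
    simpa using zero
  | @compact K hK hc hne hKA =>
    obtain ⟨a, b, hab, hI⟩ : ∃ a b, a ≤ b ∧ ℓ '' K = Icc a b := by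
      have h1 : IsCompact (ℓ '' K) := hK.image ℓ.continuous
      have h2 : IsConnected (ℓ '' K) :=
        ⟨hne.image _, hc.isPreconnected.image _ ℓ.continuous.continuousOn⟩
      have h3 := eq_Icc_of_connected_compact h2 h1
      refine ⟨_, _, ?_, h3⟩
      by_contra hlt
      rw [Icc_eq_empty hlt] at h3
      exact (hne.image ℓ).ne_empty h3
    refine ⟨fun t => if t ∈ Icc a b then 1 else 0, fun t => ?_,
      Finsupp.single b 1, by simp, fun t => ?_⟩
    · rw [indicator_indicator, inter_comm _ K]; dsimp only
      split_ifs with ht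
      · rw [← hI] at ht
        obtain ⟨x, hx, rfl⟩ := ht
        have hcl : IsClosed {y | ℓ y = ℓ x} := isClosed_eq ℓ.continuous continuous_const
        exact compact (hK.inter_right hcl)
          (hc.inter (convex_hyperplane ℓ.toLinearMap.isLinear _)) ⟨x, hx, rfl⟩
          (inter_subset_inter_left _ hKA)
      · have : K ∩ {x | ℓ x = t} = ∅ := by
          rw [eq_empty_iff_forall_notMem]
          rintro x ⟨hx, rfl⟩
          exact ht (hI ▸ mem_image_of_mem _ hx)
        rw [this, indicator_empty]
        exact zero
    · filter_upwards [eventually_add_mem_Icc_iff a b t] with ε hε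
      simp only [hε, Finsupp.single_apply, mem_Icc, mem_Ico]
      grind
  | @relOpen K U q W hU hK hq hc hb hKA =>
    have hqK : q ∈ K := (hK q).2 ⟨hq, by simp⟩
    by_cases hW : ∃ w ∈ W, ℓ w ≠ 0
    · obtain ⟨w, hw, hw0⟩ := hW
      have hopen : IsOpen (ℓ '' K) := by
        rw [isOpen_iff_mem_nhds]
        rintro _ ⟨x, hx, rfl⟩
        have hct : Continuous fun t : ℝ => x + ((t - ℓ x) / ℓ w) • w := by fun_prop
        have hev : ∀ᶠ t in 𝓝 (ℓ x), x + ((t - ℓ x) / ℓ w) • w ∈ U :=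
          hct.continuousAt.eventually (by simpa using hU.mem_nhds ((hK x).1 hx).1)
        filter_upwards [hev] with t ht
        refine ⟨_, (hK _).2 ⟨ht, ?_⟩, by simp [hw0]⟩
        rw [add_sub_right_comm]
        exact W.add_mem ((hK x).1 hx).2 (W.smul_mem _ hw)
      have hbd : Bornology.IsBounded (ℓ '' K) := ℓ.lipschitz.isBounded_image hb
      obtain ⟨a, b, hab, hI⟩ := eq_Ioo_of_isOpen_convex hopen
        (hc.is_linear_image ℓ.toLinearMap.isLinear) hbd ⟨_, mem_image_of_mem _ hqK⟩
      set W' : Submodule ℝ E := W ⊓ LinearMap.ker (ℓ : E →ₗ[ℝ] ℝ) with hW'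
      have hrank : finrank ℝ W' + 1 = finrank ℝ W := finrank_inf_ker_add_one hw hw0
      refine ⟨fun t => if t ∈ Ioo a b then (-1) ^ finrank ℝ W' else 0, fun t => ?_,
        Finsupp.single a ((-1) ^ finrank ℝ W), by simp, fun t => ?_⟩
      · rw [indicator_indicator, inter_comm _ K]; dsimp only
        split_ifs with ht
        · rw [← hI] at ht
          obtain ⟨x, hx, rfl⟩ := ht
          refine relOpen (U := U) (q := x) hU (fun y => ?_) ((hK x).1 hx).1
            (hc.inter (convex_hyperplane ℓ.toLinearMap.isLinear _))
            (hb.subset inter_subset_left) (inter_subset_inter_left _ hKA)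
          have hxq := ((hK x).1 hx).2
          have : y - x ∈ W ↔ y - q ∈ W := by
            rw [← sub_sub_sub_cancel_right y x q]
            exact W.sub_mem_iff_left hxq
          simp only [mem_inter_iff, hK y, mem_ofPred_eq, hW', Submodule.mem_inf, this,
            LinearMap.mem_ker, ContinuousLinearMap.coe_coe, map_sub, sub_eq_zero, and_assoc]
        · have : K ∩ {x | ℓ x = t} = ∅ := by
            rw [eq_empty_iff_forall_notMem]
            rintro x ⟨hx, rfl⟩
            exact ht (hI ▸ mem_image_of_mem _ hx)
          rw [this, indicator_empty]
          exact zero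
      · filter_upwards [eventually_add_mem_Ioo_iff a b t] with ε hε
        simp only [hε, Finsupp.single_apply, mem_Ioo, mem_Ico, ← hrank, pow_succ]
        grind
    · push Not at hW
      have hconst : ∀ x ∈ K, ℓ x = ℓ q := fun x hx => by
        simpa [sub_eq_zero] using hW _ ((hK x).1 hx).2
      refine ⟨fun t => if t = ℓ q then (-1) ^ finrank ℝ W else 0, fun t => ?_,
        Finsupp.single (ℓ q) ((-1) ^ finrank ℝ W), by simp, fun t => ?_⟩
      · rw [indicator_indicator, inter_comm _ K]; dsimp only
        split_ifs with ht
        · have : K ∩ {x | ℓ x = t} = K := inter_eq_left.2 fun x hx => (hconst x hx).trans ht.symm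
          rw [this]
          exact relOpen hU hK hq hc hb fun x hx => ⟨hKA hx, (hconst x hx).trans ht.symm⟩
        · have : K ∩ {x | ℓ x = t} = ∅ := by
            rw [eq_empty_iff_forall_notMem]
            rintro x ⟨hx, rfl⟩
            exact ht (hconst x hx)
          rw [this, indicator_empty]
          exact zero
      · have hne : ∀ᶠ ε in 𝓝[>] (0 : ℝ), t + ε ≠ ℓ q := by
          rcases lt_or_ge t (ℓ q) with h | h
          · filter_upwards [Ioo_mem_nhdsGT (sub_pos.2 h)] with ε hε
            linarith [hε.2]
          · filter_upwards [self_mem_nhdsWithin] with ε (hε : 0 < ε)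
            linarith
        filter_upwards [hne] with ε hε
        simp [hε, Finsupp.single_apply, eq_comm]
  | @add F G d e _ _ h₁ h₂ =>
    obtain ⟨g₁, hg₁, j₁, hj₁, hl₁⟩ := h₁
    obtain ⟨g₂, hg₂, j₂, hj₂, hl₂⟩ := h₂
    refine ⟨g₁ + g₂, fun t => ?_, j₁ + j₂, ?_, fun t => ?_⟩
    · rw [indicator_add']
      exact (hg₁ t).add (hg₂ t)
    · rw [Finsupp.sum_add_index' (by simp) (by simp), hj₁, hj₂]
    · filter_upwards [hl₁ t, hl₂ t] with ε h₁ h₂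
      simp only [Pi.add_apply, Finsupp.add_apply, ← h₁, ← h₂]
      ring
  | @neg F e _ h =>
    obtain ⟨g, hg, j, hj, hl⟩ := h
    refine ⟨-g, fun t => ?_, -j, ?_, fun t => ?_⟩
    · rw [indicator_neg']
      exact (hg t).neg
    · rw [← hj, Finsupp.sum_neg_index (by simp)]
      simp [Finsupp.sum]
    · filter_upwards [hl t] with ε h
      simp only [Pi.neg_apply, Finsupp.neg_apply, ← h]
      ring

/-- The set `A` confines the pieces as well as their sum, so passing to a slice lowers the dimension
available to every piece; this drives the induction. -/
theorem eq_zero_of_sub_mem [FiniteDimensional ℝ E] (n : ℕ) :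
    ∀ (W : Submodule ℝ E), finrank ℝ W = n → ∀ (A : Set E), (∀ x ∈ A, ∀ y ∈ A, x - y ∈ W) →
      ∀ e, HasEuler A 0 e → e = 0 := by
  induction n with
  | zero =>
    intro W hW A hA e he
    rcases A.eq_empty_or_nonempty with rfl | ⟨p, hp⟩
    · simpa using he.eq_apply_of_subset_singleton (p := 0) (empty_subset _)
    · refine he.eq_apply_of_subset_singleton (p := p) fun x hx => ?_
      have := hA x hx p hp
      rw [Submodule.finrank_eq_zero.1 hW] at this
      exact sub_eq_zero.1 (by simpa using this)
  | succ n ih =>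
    intro W hW A hA e he
    obtain ⟨w, hw, hw0⟩ : ∃ w ∈ W, w ≠ 0 := by
      apply W.exists_mem_ne_zero_of_ne_bot
      rintro rfl
      simp at hW
    -- Slicing along a functional that is nonzero on `W` makes `W ⊓ ker ℓ` smaller by one dimension.
    obtain ⟨ℓ, -, hℓ⟩ := exists_dual_vector ℝ w (norm_ne_zero_iff.2 hw0)
    have hℓw : ℓ w ≠ 0 := by simpa [hℓ] using hw0
    obtain ⟨g, hg, j, hj, hl⟩ := he.slice ℓ
    have hrank := finrank_inf_ker_add_one hw hℓw
    have hg0 : ∀ t, g t = 0 := fun t => by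
      refine ih (W ⊓ LinearMap.ker (ℓ : E →ₗ[ℝ] ℝ)) (by omega) (A ∩ {x | ℓ x = t})
        (fun x hx y hy => ?_) _ (by simpa using hg t)
      refine ⟨hA x hx.1 y hy.1, ?_⟩
      have h1 : ℓ x = t := hx.2
      have h2 : ℓ y = t := hy.2
      simp [h1, h2]
    have hj0 : j = 0 := by
      ext t
      obtain ⟨ε, hε⟩ := (hl t).exists
      simpa [hg0] using hε.symm
    rw [← hj, hj0, Finsupp.sum_zero_index]

theorem unique [FiniteDimensional ℝ E] {F : E → ℤ} {d e : ℤ} (hd : HasEuler univ F d)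
    (he : HasEuler univ F e) : d = e := by
  have h := hd.add he.neg
  rw [add_neg_cancel, ← sub_eq_add_neg] at h
  exact sub_eq_zero.1 (eq_zero_of_sub_mem _ ⊤ rfl _ (by simp) _ h)

end HasEuler

/-! ### Relative interiors -/

theorem exists_isOpen_intrinsicInterior_eq (s : Set E) :
    ∃ U : Set E, IsOpen U ∧ intrinsicInterior ℝ s = U ∩ affineSpan ℝ s := by
  obtain ⟨U, hU, h⟩ := isOpen_induced_iff.1
    (isOpen_interior (s := ((↑) ⁻¹' s : Set (affineSpan ℝ s))))
  refine ⟨U, hU, ?_⟩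
  rw [intrinsicInterior, ← h]
  exact (Subtype.image_preimage_coe _ _).trans (inter_comm _ _)

theorem mem_intrinsicInterior_of_isOpen {s U : Set E} (hU : IsOpen U)
    (hUs : U ∩ affineSpan ℝ s ⊆ s) {x : E} (hx : x ∈ U) (hxs : x ∈ affineSpan ℝ s) :
    x ∈ intrinsicInterior ℝ s :=
  mem_intrinsicInterior.2 ⟨⟨x, hxs⟩,
    mem_interior.2 ⟨((↑) : affineSpan ℝ s → E) ⁻¹' U, fun y hy => hUs ⟨hy, y.2⟩,
      hU.preimage continuous_subtype_val, hx⟩, rfl⟩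

/-- The homothety with centre `x` and ratio `t` carries a relative neighbourhood of `y` in `s` to
one of the image point. -/
theorem lineMap_mem_intrinsicInterior {s : Set E} (hs : Convex ℝ s) {x y : E} (hx : x ∈ s)
    (hy : y ∈ intrinsicInterior ℝ s) {t : ℝ} (ht₀ : 0 < t) (ht₁ : t ≤ 1) :
    AffineMap.lineMap x y t ∈ intrinsicInterior ℝ s := by
  obtain ⟨U, hU, hUs⟩ := exists_isOpen_intrinsicInterior_eq s
  have hyU : y ∈ U ∩ affineSpan ℝ s := hUs ▸ hy
  have hxs : x ∈ affineSpan ℝ s := subset_affineSpan _ _ hx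
  have hc : Continuous fun w : E => AffineMap.lineMap x w t⁻¹ := by
    simp only [AffineMap.lineMap_apply_module]; fun_prop
  refine mem_intrinsicInterior_of_isOpen (hU.preimage hc) ?_ ?_
    (AffineMap.lineMap_mem _ hxs hyU.2)
  · rintro w ⟨hw, hws⟩
    have h1 : AffineMap.lineMap x w t⁻¹ ∈ s :=
      intrinsicInterior_subset (𝕜 := ℝ) (hUs ▸ ⟨hw, AffineMap.lineMap_mem _ hxs hws⟩)
    have h2 := hs.lineMap_mem hx h1 ⟨ht₀.le, ht₁⟩
    rwa [AffineMap.lineMap_lineMap_right, mul_inv_cancel₀ ht₀.ne', AffineMap.lineMap_apply_one]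
      at h2
  · rw [mem_preimage, AffineMap.lineMap_lineMap_right, inv_mul_cancel₀ ht₀.ne',
      AffineMap.lineMap_apply_one]
    exact hyU.1

theorem convex_intrinsicInterior {s : Set E} (hs : Convex ℝ s) :
    Convex ℝ (intrinsicInterior ℝ s) := by
  rw [convex_iff_segment_subset]
  intro x hx y hy
  rw [segment_eq_image_lineMap]
  rintro _ ⟨t, ht, rfl⟩
  rcases ht.1.eq_or_lt with rfl | h0
  · simpa using hx
  · exact lineMap_mem_intrinsicInterior hs (intrinsicInterior_subset hx) hy h0 ht.2

theorem exists_one_lt_lineMap_mem_intrinsicInterior {s : Set E} {x y : E} (hy : y ∈ affineSpan ℝ s)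
    (hx : x ∈ intrinsicInterior ℝ s) :
    ∃ t : ℝ, 1 < t ∧ AffineMap.lineMap y x t ∈ intrinsicInterior ℝ s := by
  obtain ⟨U, hU, hUs⟩ := exists_isOpen_intrinsicInterior_eq s
  have hxU : x ∈ U ∩ affineSpan ℝ s := hUs ▸ hx
  have hc : Continuous fun t : ℝ => (AffineMap.lineMap y x t : E) := AffineMap.lineMap_continuous
  have hev : ∀ᶠ t in 𝓝[>] (1 : ℝ), (AffineMap.lineMap y x t : E) ∈ U :=
    (hc.tendsto 1).mono_left nhdsWithin_le_nhds |>.eventually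
      (by simpa using hU.mem_nhds hxU.1)
  obtain ⟨t, htU, ht⟩ := (hev.and self_mem_nhdsWithin).exists
  exact ⟨t, ht, hUs ▸ ⟨htU, AffineMap.lineMap_mem _ hy hxU.2⟩⟩

/-- An affine function which is minimized over `s` at a relatively interior point of `s` is
constant on `s`. -/
theorem eq_of_forall_le_of_mem_intrinsicInterior {s : Set E} {a : E →ᵃ[ℝ] ℝ} {x : E}
    (hx : x ∈ intrinsicInterior ℝ s) (h : ∀ y ∈ s, a x ≤ a y) {y : E} (hy : y ∈ s) :
    a y = a x := by
  obtain ⟨t, ht, hts⟩ :=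
    exists_one_lt_lineMap_mem_intrinsicInterior (subset_affineSpan ℝ s hy) hx
  have h1 := h _ (intrinsicInterior_subset hts)
  rw [AffineMap.apply_lineMap, AffineMap.lineMap_apply_module] at h1
  have h2 := h y hy
  simp only [smul_eq_mul] at h1
  nlinarith

/-! ### Faces as exposed sets -/

/-- A segment from a point of `f` to `x` can be prolonged beyond `x` within `f`; extremality of `g`
then captures its starting point. -/
theorem _root_.IsExposed.subset_of_mem_intrinsicInterior {P f g : Set E} (hg : IsExposed ℝ P g)
    (hf : f ⊆ P) {x : E} (hx : x ∈ intrinsicInterior ℝ f) (hxg : x ∈ g) : f ⊆ g := by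
  intro y hy
  obtain ⟨t, ht, hts⟩ :=
    exists_one_lt_lineMap_mem_intrinsicInterior (subset_affineSpan ℝ f hy) hx
  refine hg.isExtreme.left_mem_of_mem_openSegment (hf hy) (hf (intrinsicInterior_subset hts)) hxg ?_
  rw [openSegment_eq_image_lineMap]
  refine ⟨t⁻¹, ⟨by positivity, inv_lt_one_of_one_lt₀ ht⟩, ?_⟩
  rw [AffineMap.lineMap_lineMap_right, inv_mul_cancel₀ (by positivity),
    AffineMap.lineMap_apply_one]

theorem eq_of_isExposed_of_mem_intrinsicInterior {P f g : Set E} (hf : IsExposed ℝ P f)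
    (hg : IsExposed ℝ P g) {x : E} (hxf : x ∈ intrinsicInterior ℝ f)
    (hxg : x ∈ intrinsicInterior ℝ g) : f = g :=
  (hg.subset_of_mem_intrinsicInterior hf.subset hxf (intrinsicInterior_subset hxg)).antisymm
    (hf.subset_of_mem_intrinsicInterior hg.subset hxg (intrinsicInterior_subset hxf))

theorem isExposed_of_forall_le {P : Set E} {a : E →L[ℝ] ℝ} {b : ℝ} (h : ∀ x ∈ P, b ≤ a x) :
    IsExposed ℝ P (P ∩ {x | a x = b}) := by
  rintro ⟨x, hx, hxb⟩
  refine ⟨-a, ?_⟩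
  ext y
  simp only [mem_inter_iff, mem_ofPred_eq, neg_apply, neg_le_neg_iff]
  refine and_congr_right fun hy => ⟨fun hyb z hz => hyb ▸ h z hz, fun hyz => ?_⟩
  exact le_antisymm ((hyz x hx).trans_eq hxb) (h y hy)

theorem _root_.IsExposed.exists_eq_inter {P f : Set E} (h : IsExposed ℝ P f) (hf : f.Nonempty) :
    ∃ (a : E →L[ℝ] ℝ) (b : ℝ), (∀ x ∈ P, b ≤ a x) ∧ f = P ∩ {x | a x = b} := by
  obtain ⟨l, hl⟩ := h hf
  obtain ⟨x, hx⟩ := hf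
  rw [hl] at hx
  refine ⟨-l, -l x, fun y hy => by simpa using hx.2 y hy, ?_⟩
  rw [hl]
  ext y
  simp only [mem_inter_iff, mem_ofPred_eq, neg_apply, neg_inj]
  exact and_congr_right fun hy => ⟨fun h => le_antisymm (hx.2 y hy) (h x hx.1),
    fun h z hz => h ▸ hx.2 z hz⟩

/-- Points on the segment from a point of `P` to a relatively interior point, the start excluded,
are relatively interior. A hyperplane missing the relative interior therefore leaves `P` on one
side, and the halfspace cuts out either all of `P` or a set of minimizers. -/
theorem isFace_iff_isExposed [FiniteDimensional ℝ E] {P f : Set E} (hP : Convex ℝ P) :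
    IsFace P f ↔ IsExposed ℝ P f := by
  constructor
  · rintro (rfl | rfl | ⟨a, -, b, hd, rfl⟩)
    · exact isExposed_empty
    · exact .refl _
    · rcases P.eq_empty_or_nonempty with rfl | hne
      · simpa using isExposed_empty
      obtain ⟨y, hy⟩ := (intrinsicInterior_nonempty hP).2 hne
      have hmid (x : E) (hx : x ∈ P) (t : ℝ) (ht₀ : 0 < t) (ht₁ : t ≤ 1) :
          a x + t * (a y - a x) ≠ b := fun hab => by
        refine disjoint_left.1 hd ?_ (lineMap_mem_intrinsicInterior hP hx hy ht₀ ht₁)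
        rw [mem_ofPred_eq, ← hab, AffineMap.lineMap_apply_module']
        simp; ring
      have hyb : a y ≠ b := by simpa using hmid y (intrinsicInterior_subset hy) 1 (by simp) le_rfl
      rcases hyb.lt_or_gt with hlt | hgt
      · have : P ⊆ {x | a x ≤ b} := fun x hx => by
          by_contra hx'
          simp only [mem_ofPred_eq, not_le] at hx'
          have h0 : 0 < a x - a y := by linarith
          refine hmid x hx ((a x - b) / (a x - a y)) (div_pos (by linarith) h0)
            ((div_le_one h0).2 (by linarith)) ?_
          field_simp
          ring
        rw [inter_eq_left.2 this]
      · have hle : ∀ x ∈ P, b ≤ a x := fun x hx => by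
          by_contra! hx'
          have h0 : 0 < a y - a x := by linarith
          refine hmid x hx ((b - a x) / (a y - a x)) (div_pos (by linarith) h0)
            ((div_le_one h0).2 (by linarith)) ?_
          field_simp
          ring
        convert isExposed_of_forall_le hle using 1
        ext x
        simp only [mem_inter_iff, mem_ofPred_eq]
        exact and_congr_right fun hx => ⟨fun h => h.antisymm (hle x hx), fun h => h.le⟩
  · intro h
    rcases f.eq_empty_or_nonempty with rfl | hne
    · exact .inl rfl
    obtain ⟨a, b, hab, rfl⟩ := h.exists_eq_inter hne
    by_cases hd : a ≠ 0 ∧ Disjoint {x | a x = b} (intrinsicInterior ℝ P)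
    · refine .inr (.inr ⟨a, hd.1, b, hd.2, ?_⟩)
      ext x
      simp only [mem_inter_iff, mem_ofPred_eq]
      exact and_congr_right fun hx => ⟨fun h => h.le, fun h => h.antisymm (hab x hx)⟩
    -- The functional is zero or attains its minimum at a relatively interior point; either way it
    -- is constant on `P`.
    · refine .inr (.inl (inter_eq_left.2 fun x hx => ?_))
      obtain ⟨z, hz, hzb⟩ := hne
      by_cases ha : a = 0
      · simpa [ha] using hzb
      obtain ⟨y, hyb, hy⟩ := not_disjoint_iff.1 fun h => hd ⟨ha, h⟩
      have hyb' : a y = b := hyb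
      exact (eq_of_forall_le_of_mem_intrinsicInterior (a := a.toLinearMap.toAffineMap) hy
        (fun w hw => by simpa [hyb'] using hab w hw) hx).trans hyb

/-- `P` is closed and convex, has finitely many exposed faces, and their relative interiors
cover it. -/
structure HasFiniteFaces (P : Set E) : Prop where
  convex : Convex ℝ P
  isClosed : IsClosed P
  finite : {f | IsExposed ℝ P f}.Finite
  cover : ∀ x ∈ P, ∃ f, IsExposed ℝ P f ∧ x ∈ intrinsicInterior ℝ f

/-- The convex set of solutions of finitely many linear inequalities `a i x ≤ b i`. -/
def solutionSet {ι : Type*} (a : ι → E →L[ℝ] ℝ) (b : ι → ℝ) : Set E := {x | ∀ i, a i x ≤ b i}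

/-! ### Faces of a polyhedron -/

section Polyhedron

variable {ι : Type*} (a : ι → E →L[ℝ] ℝ) (b : ι → ℝ)

theorem IsPolyhedron.exists_eq_solutionSet {P : Set E} (hP : IsPolyhedron P) :
    ∃ (ι : Type u) (_ : Fintype ι) (a : ι → E →L[ℝ] ℝ) (b : ι → ℝ), P = solutionSet a b := by
  obtain ⟨T, hT, hH, rfl⟩ := hP
  choose a _ b hab using fun H : T => hH H H.2
  refine ⟨T, hT.fintype, a, b, ?_⟩
  ext x
  simp only [mem_sInter, solutionSet, mem_ofPred_eq]
  constructor
  · intro h i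
    have := h i i.2
    rw [hab i] at this
    exact this
  · intro h H hHT
    rw [show H = _ from hab ⟨H, hHT⟩]
    exact h ⟨H, hHT⟩

/-- The points of the solution set at which all inequalities in `J` are sharp. -/
def activeFace (J : Set ι) : Set E := solutionSet a b ∩ {x | ∀ i ∈ J, a i x = b i}

theorem isClosed_solutionSet : IsClosed (solutionSet a b) := by
  simp only [solutionSet, ofPred_forall]
  exact isClosed_iInter fun i => isClosed_le (a i).continuous continuous_const

theorem convex_solutionSet : Convex ℝ (solutionSet a b) := by
  simp only [solutionSet, ofPred_forall]
  exact convex_iInter fun i => convex_halfSpace_le (a i).toLinearMap.isLinear _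

/-- The sum of the inequalities in `J` is sharp only where each of them is. -/
theorem isExposed_activeFace [Fintype ι] (J : Set ι) :
    IsExposed ℝ (solutionSet a b) (activeFace a b J) := by
  classical
  have h (y : E) (hy : y ∈ solutionSet a b) :
      -∑ i with i ∈ J, b i ≤ (-∑ i with i ∈ J, a i : E →L[ℝ] ℝ) y := by
    simp only [neg_apply, sum_apply, neg_le_neg_iff]
    exact Finset.sum_le_sum fun i _ => hy i
  convert isExposed_of_forall_le h using 1
  ext y
  simp only [activeFace, mem_inter_iff, mem_ofPred_eq, neg_apply, sum_apply,
    neg_inj]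
  refine and_congr_right fun hy => ?_
  rw [Finset.sum_eq_sum_iff_of_le fun i _ => hy i]
  simp

/-- Constraints strict at `x` remain strict nearby, and those sharp at `x` hold with equality on the
whole affine span of the face. -/
theorem mem_intrinsicInterior_activeFace [Fintype ι] {x : E} (hx : x ∈ solutionSet a b) :
    x ∈ intrinsicInterior ℝ (activeFace a b {i | a i x = b i}) := by
  have hxf : x ∈ activeFace a b {i | a i x = b i} := ⟨hx, fun i hi => hi⟩
  have hopen : IsOpen {y | ∀ i, a i x < b i → a i y < b i} := by
    simp only [ofPred_forall]
    exact isOpen_iInter_of_finite fun i => isOpen_iInter_of_finite fun _ =>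
      isOpen_lt (a i).continuous continuous_const
  refine mem_intrinsicInterior_of_isOpen hopen ?_ (fun i hi => hi) (subset_affineSpan _ _ hxf)
  rintro y ⟨hy, hys⟩
  have heq : ∀ i, a i x = b i → a i y = b i := fun i hi => by
    have hle : affineSpan ℝ (activeFace a b {i | a i x = b i}) ≤
        (affineSpan ℝ {b i}).comap (a i).toLinearMap.toAffineMap := by
      rw [affineSpan_le]
      intro z hz
      simpa using hz.2 i hi
    simpa using hle hys
  refine ⟨fun i => ?_, heq⟩
  rcases (hx i).eq_or_lt with h | h
  · exact (heq i h).le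
  · exact (hy i h).le

/-- A nonempty face is the active face of any of its relatively interior points, so there are at
most as many as sets of constraints. -/
theorem hasFiniteFaces_solutionSet [FiniteDimensional ℝ E] [Fintype ι] :
    HasFiniteFaces (solutionSet a b) where
  convex := convex_solutionSet a b
  isClosed := isClosed_solutionSet a b
  finite := by
    refine ((finite_range (activeFace a b)).insert ∅).subset fun f hf => ?_
    rcases f.eq_empty_or_nonempty with rfl | hne
    · exact mem_insert _ _
    obtain ⟨x, hx⟩ :=
      (intrinsicInterior_nonempty (hf.convex (convex_solutionSet a b))).2 hne
    refine mem_insert_of_mem _ ⟨_, eq_of_isExposed_of_mem_intrinsicInterior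
      (isExposed_activeFace a b _) hf (mem_intrinsicInterior_activeFace a b ?_) hx⟩
    exact hf.subset (intrinsicInterior_subset hx)
  cover := fun x hx => ⟨_, isExposed_activeFace a b _, mem_intrinsicInterior_activeFace a b hx⟩

end Polyhedron

/-! ### Faces of a polytope -/

section Polytope

theorem _root_.IsExposed.eq_convexHull {S f : Set E} (hS : S.Finite)
    (hf : IsExposed ℝ (convexHull ℝ S) f) : f = convexHull ℝ (S ∩ f) := by
  refine Subset.antisymm ?_ (convexHull_min inter_subset_right (hf.convex (convex_convexHull ℝ S)))
  have hfc : IsCompact f := hf.isCompact (hS.isCompact_convexHull ℝ)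
  conv_lhs => rw [← closure_convexHull_extremePoints hfc (hf.convex (convex_convexHull ℝ S))]
  refine closure_minimal (convexHull_mono ?_) ((hS.inter_of_left f).isClosed_convexHull ℝ)
  exact subset_inter
    (hf.isExtreme.extremePoints_subset_extremePoints.trans extremePoints_convexHull_subset)
    extremePoints_subset

/-- If `l` exposes `f` and `m` exposes `g` in `f`, then `N • l + m` exposes `g` once `N` is large
enough to penalize each of the finitely many points of `S` outside `f`. -/
theorem _root_.IsExposed.trans_of_finite {S f g : Set E} (hS : S.Finite)
    (hf : IsExposed ℝ (convexHull ℝ S) f) (hg : IsExposed ℝ f g) :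
    IsExposed ℝ (convexHull ℝ S) g := by
  rcases g.eq_empty_or_nonempty with rfl | hne
  · exact isExposed_empty
  obtain ⟨m, β, hm, rfl⟩ := hg.exists_eq_inter hne
  obtain ⟨l, α, hl, hfl⟩ := hf.exists_eq_inter (hne.mono inter_subset_left)
  have hlf : ∀ x ∈ f, l x = α := fun x hx => (hfl ▸ hx : x ∈ _ ∩ {x | l x = α}).2
  have hN : ∀ᶠ N : ℝ in atTop, ∀ s ∈ S, α < l s → N * α + β < N * l s + m s := by
    refine (eventually_all_finite hS).2 fun s _ => ?_
    by_cases h : α < l s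
    · filter_upwards [eventually_gt_atTop ((β - m s) / (l s - α))] with N hN _
      rw [div_lt_iff₀ (sub_pos.2 h)] at hN
      linarith
    · exact Eventually.of_forall fun _ h' => absurd h' h
  obtain ⟨N, hN⟩ := hN.exists
  have hSf : ∀ s ∈ S, ¬ α < l s → s ∈ f := fun s hs h => by
    rw [hfl]
    exact ⟨subset_convexHull _ _ hs, le_antisymm (not_lt.1 h) (hl s (subset_convexHull _ _ hs))⟩
  have hle : ∀ x ∈ convexHull ℝ S, N * α + β ≤ (N • l + m) x := by
    refine convexHull_min (fun s hs => ?_)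
      (convex_halfSpace_ge (N • l + m).toLinearMap.isLinear (N * α + β))
    change N * α + β ≤ (N • l + m) s
    by_cases h : α < l s
    · simpa using (hN s hs h).le
    · have hsf := hSf s hs h
      simpa [hlf s hsf] using hm s hsf
  have hF := isExposed_of_forall_le hle
  convert hF using 1
  refine Subset.antisymm (fun x hx => ⟨hf.subset hx.1, ?_⟩) (fun x hx => ?_)
  · have : m x = β := hx.2
    simp [hlf x hx.1, this]
  · have hxf : x ∈ f := by
      rw [hF.eq_convexHull hS] at hx
      refine convexHull_min ?_ (hf.convex (convex_convexHull ℝ S)) hx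
      rintro s ⟨hs, -, hsN⟩
      refine hSf s hs fun h => (hN s hs h).ne' ?_
      simpa using hsN
    refine ⟨hxf, ?_⟩
    simpa [hlf x hxf] using hx.2

/-- Separation takes place in the direction space of the affine span, where the relative interior is
open; this makes the functional nonconstant on `f`. -/
theorem exists_forall_le_of_notMem_intrinsicInterior [FiniteDimensional ℝ E] {f : Set E}
    (hf : Convex ℝ f) {x : E} (hx : x ∈ f) (hx' : x ∉ intrinsicInterior ℝ f) :
    ∃ l : E →L[ℝ] ℝ, (∀ y ∈ f, l x ≤ l y) ∧ ∃ y ∈ f, l x < l y := by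
  obtain ⟨U, hU, hUf⟩ := exists_isOpen_intrinsicInterior_eq f
  have hxs := subset_affineSpan ℝ f hx
  let φ : (affineSpan ℝ f).direction →ᵃ[ℝ] E :=
    (affineSpan ℝ f).direction.subtype.toAffineMap + AffineMap.const ℝ _ x
  have hφ (v : (affineSpan ℝ f).direction) : φ v = v + x := rfl
  have hφs (v) : φ v ∈ affineSpan ℝ f := AffineSubspace.vadd_mem_of_mem_direction v.2 hxs
  have hopen : IsOpen (φ ⁻¹' intrinsicInterior ℝ f) := by
    have : φ ⁻¹' intrinsicInterior ℝ f = φ ⁻¹' U := by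
      ext v
      simp only [mem_preimage, hUf, mem_inter_iff]
      exact and_iff_left (hφs v)
    rw [this]
    exact hU.preimage (continuous_subtype_val.add continuous_const)
  obtain ⟨g, hg⟩ := geometric_hahn_banach_point_open (x := 0)
    ((convex_intrinsicInterior hf).affine_preimage φ) hopen (by simpa [hφ] using hx')
  obtain ⟨l, hl, -⟩ := exists_extension_norm_eq _ g
  have hlt : ∀ y ∈ intrinsicInterior ℝ f, l x < l y := fun y hy => by
    have hv : y - x ∈ (affineSpan ℝ f).direction :=
      AffineSubspace.vsub_mem_direction (subset_affineSpan ℝ f (intrinsicInterior_subset hy)) hxs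
    have h1 := hg ⟨y - x, hv⟩ (by simpa [hφ] using hy)
    rw [map_zero, ← hl] at h1
    simpa using h1
  obtain ⟨y₀, hy₀⟩ := (intrinsicInterior_nonempty hf).2 ⟨x, hx⟩
  refine ⟨l, fun y hy => ?_, y₀, intrinsicInterior_subset hy₀, hlt y₀ hy₀⟩
  by_contra! h
  have h0 : 0 < l y₀ - l y := by linarith [hlt y₀ hy₀]
  have h1 := hlt _ (lineMap_mem_intrinsicInterior hf hy hy₀ (t := (l x - l y) / (l y₀ - l y))
    (div_pos (by linarith) h0) ((div_le_one h0).2 (by linarith [hlt y₀ hy₀])))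
  rw [AffineMap.lineMap_apply_module', map_add, map_smul, map_sub, smul_eq_mul,
    div_mul_cancel₀ _ h0.ne'] at h1
  linarith

/-- A minimal face containing `x` has `x` in its relative interior: otherwise a supporting
functional at `x` cuts out a smaller face of that face, which is again a face of the polytope. -/
theorem hasFiniteFaces_convexHull [FiniteDimensional ℝ E] {S : Set E} (hS : S.Finite) :
    HasFiniteFaces (convexHull ℝ S) := by
  have hfin : {f | IsExposed ℝ (convexHull ℝ S) f}.Finite :=
    (hS.finite_subsets.image (convexHull ℝ)).subset
      fun f hf => ⟨S ∩ f, inter_subset_left, (hf.eq_convexHull hS).symm⟩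
  refine ⟨convex_convexHull ℝ S, hS.isClosed_convexHull ℝ, hfin, fun x hx => ?_⟩
  obtain ⟨f, ⟨hf, hxf⟩, hmin⟩ := (hfin.subset (sep_subset _ fun f => x ∈ f)).exists_minimal
    ⟨_, IsExposed.refl _, hx⟩
  refine ⟨f, hf, ?_⟩
  by_contra hx'
  obtain ⟨l, hl, y, hy, hxy⟩ :=
    exists_forall_le_of_notMem_intrinsicInterior (hf.convex (convex_convexHull ℝ S)) hxf hx'
  have hg := hf.trans_of_finite hS (isExposed_of_forall_le hl)
  have : l y = l x := (hmin ⟨hg, hxf, rfl⟩ inter_subset_left hy).2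
  exact hxy.ne' this

end Polytope

/-! ### Counting faces below a closed level -/

theorem hasEuler_intrinsicInterior_inter {f V : Set E} (hf : Convex ℝ f) (hV : IsOpen V)
    (hVc : Convex ℝ V) (hne : (intrinsicInterior ℝ f ∩ V).Nonempty)
    (hb : Bornology.IsBounded (intrinsicInterior ℝ f ∩ V)) :
    HasEuler univ ((intrinsicInterior ℝ f ∩ V).indicator 1)
      ((-1) ^ finrank ℝ (affineSpan ℝ f).direction) := by
  obtain ⟨U, hU, hUf⟩ := exists_isOpen_intrinsicInterior_eq f
  obtain ⟨q, hq, hqV⟩ := hne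
  rw [hUf] at hq
  refine .relOpen (U := U ∩ V) (q := q) (hU.inter hV) (fun x => ?_) ⟨hq.1, hqV⟩
    ((convex_intrinsicInterior hf).inter hVc) hb (subset_univ _)
  have : x - q ∈ (affineSpan ℝ f).direction ↔ x ∈ affineSpan ℝ f :=
    AffineSubspace.vsub_right_mem_direction_iff_mem hq.2 x
  rw [hUf, this]
  simp only [mem_inter_iff, SetLike.mem_coe]
  tauto

theorem hasEuler_intrinsicInterior_inter_hyperplane {f : Set E} (hf : Convex ℝ f)
    (ℓ : E →L[ℝ] ℝ) {c : ℝ} (hne : (intrinsicInterior ℝ f ∩ {x | ℓ x = c}).Nonempty)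
    (hb : Bornology.IsBounded (intrinsicInterior ℝ f ∩ {x | ℓ x = c})) :
    HasEuler univ ((intrinsicInterior ℝ f ∩ {x | ℓ x = c}).indicator 1)
      ((-1) ^ finrank ℝ
        ((affineSpan ℝ f).direction ⊓ LinearMap.ker (ℓ : E →ₗ[ℝ] ℝ) : Submodule ℝ E)) := by
  obtain ⟨U, hU, hUf⟩ := exists_isOpen_intrinsicInterior_eq f
  obtain ⟨q, hq, rfl⟩ := hne
  rw [hUf] at hq
  refine .relOpen (U := U) (q := q) hU (fun x => ?_) hq.1
    ((convex_intrinsicInterior hf).inter (convex_hyperplane ℓ.toLinearMap.isLinear _)) hb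
    (subset_univ _)
  have : x - q ∈ (affineSpan ℝ f).direction ↔ x ∈ affineSpan ℝ f :=
    AffineSubspace.vsub_right_mem_direction_iff_mem hq.2 x
  rw [hUf, Submodule.mem_inf, this]
  simp only [mem_inter_iff, SetLike.mem_coe, mem_ofPred_eq, LinearMap.mem_ker,
    ContinuousLinearMap.coe_coe, map_sub, sub_eq_zero]
  tauto

open Classical in
-- If `f` leaves the halfspace and its truncated relative interior is nonempty, the parts ℓ < c and
-- ℓ = c are both nonempty, with opposite weights.
theorem hasEuler_intrinsicInterior_inter_halfspace [FiniteDimensional ℝ E] {f : Set E}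
    (hf : Convex ℝ f) (hne : f.Nonempty) (ℓ : E →L[ℝ] ℝ) (c : ℝ)
    (hb : Bornology.IsBounded (f ∩ {x | ℓ x ≤ c})) :
    HasEuler univ ((intrinsicInterior ℝ f ∩ {x | ℓ x ≤ c}).indicator 1)
      (if ∀ p ∈ f, ℓ p ≤ c then (-1) ^ finrank ℝ (affineSpan ℝ f).direction else 0) := by
  have hsub : intrinsicInterior ℝ f ∩ {x | ℓ x ≤ c} ⊆ f ∩ {x | ℓ x ≤ c} :=
    inter_subset_inter_left _ intrinsicInterior_subset
  have hbi := hb.subset hsub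
  split_ifs with h
  · have heq : intrinsicInterior ℝ f ∩ {x | ℓ x ≤ c} = intrinsicInterior ℝ f ∩ univ := by
      rw [inter_univ]
      exact inter_eq_left.2 fun x hx => h x (intrinsicInterior_subset hx)
    rw [heq] at hbi ⊢
    exact hasEuler_intrinsicInterior_inter hf isOpen_univ convex_univ
      (by simpa using (intrinsicInterior_nonempty hf).2 hne) hbi
  · push Not at h
    obtain ⟨p, hp, hpc⟩ := h
    rcases (intrinsicInterior ℝ f ∩ {x | ℓ x ≤ c}).eq_empty_or_nonempty with h0 | ⟨q, hq, hqc⟩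
    · rw [h0, indicator_empty]
      exact .zero
    replace hqc : ℓ q ≤ c := hqc
    -- Prolonging the segment from `p`, where ℓ > c, beyond `q` gives a relatively interior point
    -- strictly below `c`; between it and `p` lies one at level `c`.
    obtain ⟨t, ht, hts⟩ :=
      exists_one_lt_lineMap_mem_intrinsicInterior (subset_affineSpan ℝ f hp) hq
    set z := AffineMap.lineMap p q t with hz
    have hzc : ℓ z < c := by
      rw [hz, AffineMap.lineMap_apply_module', map_add, map_smul, map_sub, smul_eq_mul]
      nlinarith
    have h0 : 0 < ℓ p - ℓ z := by linarith
    have hys := lineMap_mem_intrinsicInterior hf hp hts (t := (ℓ p - c) / (ℓ p - ℓ z))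
      (div_pos (by linarith) h0) ((div_le_one h0).2 (by linarith))
    set y := AffineMap.lineMap p z ((ℓ p - c) / (ℓ p - ℓ z)) with hy
    have hyc : ℓ y = c := by
      rw [hy, AffineMap.lineMap_apply_module', map_add, map_smul, map_sub, smul_eq_mul]
      field_simp
      ring
    have hrank := HasEuler.finrank_inf_ker_add_one (ℓ := ℓ)
      (AffineSubspace.vsub_mem_direction
        (subset_affineSpan ℝ f (intrinsicInterior_subset hts))
        (subset_affineSpan ℝ f (intrinsicInterior_subset hys)))
      (by rw [vsub_eq_sub, map_sub, hyc]; linarith)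
    have h1 := hasEuler_intrinsicInterior_inter hf (V := {x | ℓ x < c})
      (isOpen_lt ℓ.continuous continuous_const) (convex_halfSpace_lt ℓ.toLinearMap.isLinear _)
      ⟨z, hts, hzc⟩ (hbi.subset (inter_subset_inter_right _ fun x (hx : ℓ x < c) => hx.le))
    have h2 := hasEuler_intrinsicInterior_inter_hyperplane hf ℓ (c := c) ⟨y, hys, hyc⟩
      (hbi.subset (inter_subset_inter_right _ fun x (hx : ℓ x = c) => hx.le))
    convert h1.add h2 using 1
    · refine Eq.trans ?_ (indicator_union_of_disjoint (disjoint_left.2 ?_) 1)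
      · rw [← inter_union_distrib_left]
        congr 2
        ext x
        exact le_iff_lt_or_eq (a := ℓ x) (b := c)
      · rintro x ⟨-, h3⟩ ⟨-, h4⟩
        exact h3.ne h4
    · rw [← hrank, pow_succ]
      ring

theorem HasFiniteFaces.finite_and_eulerChar_eq_zero [FiniteDimensional ℝ E] {P : Set E}
    (hP : HasFiniteFaces P) (ℓ : E →L[ℝ] ℝ) (c : ℝ) (hne : (P ∩ {x | ℓ x ≤ c}).Nonempty)
    (hb : Bornology.IsBounded (P ∩ {x | ℓ x ≤ c})) :
    {f | IsFace P f ∧ ∀ p ∈ f, ℓ p ≤ c}.Finite ∧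
      eulerChar {f | IsFace P f ∧ ∀ p ∈ f, ℓ p ≤ c} = 0 := by
  classical
  have hfin : {f | IsExposed ℝ P f ∧ f.Nonempty}.Finite := hP.finite.subset fun f hf => hf.1
  set 𝓕 := hfin.toFinset with h𝓕
  have hmem (f : Set E) : f ∈ 𝓕 ↔ IsExposed ℝ P f ∧ f.Nonempty := by simp [h𝓕]
  have hC : {f | IsFace P f ∧ ∀ p ∈ f, ℓ p ≤ c} =
      ↑(insert ∅ (𝓕.filter fun f => ∀ p ∈ f, ℓ p ≤ c)) := by
    ext f
    simp only [mem_ofPred_eq, isFace_iff_isExposed hP.convex, Finset.coe_insert, mem_insert_iff,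
      Finset.mem_coe, Finset.mem_filter, hmem]
    rcases f.eq_empty_or_nonempty with rfl | hf
    · simp [isExposed_empty]
    · simp [hf, hf.ne_empty]
  have hQ : HasEuler univ ((P ∩ {x | ℓ x ≤ c}).indicator 1) 1 := by
    refine .compact ?_ (hP.convex.inter (convex_halfSpace_le ℓ.toLinearMap.isLinear _)) hne
      (subset_univ _)
    exact Metric.isCompact_of_isClosed_isBounded
      (hP.isClosed.inter (isClosed_le ℓ.continuous continuous_const)) hb
  have hsum := HasEuler.sum 𝓕 fun f hf => hasEuler_intrinsicInterior_inter_halfspace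
    (((hmem f).1 hf).1.convex hP.convex) ((hmem f).1 hf).2 ℓ c
    (hb.subset (inter_subset_inter_left _ ((hmem f).1 hf).1.subset))
  have hpart : ∑ f ∈ 𝓕, (intrinsicInterior ℝ f ∩ {x | ℓ x ≤ c}).indicator (1 : E → ℤ) =
      (P ∩ {x | ℓ x ≤ c}).indicator 1 := by
    ext x
    rw [Finset.sum_apply]
    by_cases hx : x ∈ P ∩ {x | ℓ x ≤ c}
    · obtain ⟨f, hf, hxf⟩ := hP.cover x hx.1
      have hxf' : x ∈ intrinsicInterior ℝ f ∩ {x | ℓ x ≤ c} := ⟨hxf, hx.2⟩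
      rw [indicator_of_mem hx, Finset.sum_eq_single_of_mem f
        ((hmem f).2 ⟨hf, x, intrinsicInterior_subset hxf⟩), indicator_of_mem hxf']
      intro g hg hgf
      refine indicator_of_notMem (fun hxg => hgf ?_) _
      exact eq_of_isExposed_of_mem_intrinsicInterior ((hmem g).1 hg).1 hf hxg.1 hxf
    · rw [indicator_of_notMem hx]
      refine Finset.sum_eq_zero fun f hf => indicator_of_notMem (fun hxf => hx ?_) _
      exact ⟨((hmem f).1 hf).1.subset (intrinsicInterior_subset hxf.1), hxf.2⟩
  rw [hpart] at hsum
  have key := hsum.unique hQ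
  rw [hC]
  refine ⟨Finset.finite_toSet _, ?_⟩
  -- The empty face has dimension -1 and cancels the weight 1 of the truncation.
  rw [eulerChar, finsum_mem_coe_finset, Finset.sum_insert (by simp [hmem])]
  have hw : ∀ f ∈ 𝓕.filter fun f => ∀ p ∈ f, ℓ p ≤ c,
      ((((-1 : ℤˣ) ^ faceDim f : ℤˣ) : ℤ)) = (-1) ^ finrank ℝ (affineSpan ℝ f).direction := by
    intro f hf
    have hf0 : f ≠ ∅ := ((hmem f).1 (Finset.mem_filter.1 hf).1).2.ne_empty
    simp [faceDim, hf0]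
  rw [Finset.sum_congr rfl hw, Finset.sum_filter, key]
  simp [faceDim]

/-! ### Recession directions and bounded truncations -/

theorem nonpos_of_forall_add_mul_le {α β c : ℝ} (h : ∀ t : ℝ, 0 ≤ t → α + t * β ≤ c) : β ≤ 0 := by
  by_contra! hβ
  have h0 := h 0 le_rfl
  have h1 := h ((c - α + 1) / β) (div_nonneg (by linarith) hβ.le)
  rw [div_mul_cancel₀ _ hβ.ne'] at h1
  linarith

theorem eq_zero_of_forall_add_smul_mem {s : Set E} (hs : Bornology.IsBounded s) {x v : E}
    (h : ∀ t : ℝ, 0 ≤ t → x + t • v ∈ s) : v = 0 := by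
  obtain ⟨R, hR⟩ := hs.exists_norm_le
  have : ‖v‖ ≤ 0 := by
    refine nonpos_of_forall_add_mul_le (α := -‖x‖) (c := R) fun t ht => ?_
    have h1 := hR _ (h t ht)
    have h2 := norm_sub_norm_le (t • v) (-x)
    rw [sub_neg_eq_add, norm_neg, norm_smul, Real.norm_of_nonneg ht, add_comm (t • v)] at h2
    linarith
  exact norm_le_zero_iff.1 this

theorem exists_ray_of_not_isBounded [FiniteDimensional ℝ E] {s : Set E} (hs : Convex ℝ s)
    (hc : IsClosed s) (hb : ¬ Bornology.IsBounded s) :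
    ∃ x ∈ s, ∃ v ≠ 0, ∀ y ∈ s, ∀ t : ℝ, 0 ≤ t → y + t • v ∈ s := by
  obtain ⟨v, hv0, hv⟩ := not_bounded_iff_exists_ne_zero_mem_asymptoticCone.1 hb
  obtain ⟨x, hx⟩ : s.Nonempty := by
    by_contra h
    rw [not_nonempty_iff_eq_empty.1 h] at hb
    exact hb Bornology.isBounded_empty
  refine ⟨x, hx, v, hv0, fun y hy t ht => ?_⟩
  have := hs.smul_vadd_mem_of_isClosed_of_mem_asymptoticCone hc ht hv hy
  rwa [vadd_eq_add, add_comm] at this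

section SolutionSet

variable {ι : Type*} (a : ι → E →L[ℝ] ℝ) (b : ι → ℝ)

theorem exists_pos_add_smul_mem_solutionSet [Finite ι] {x w : E} (hx : x ∈ solutionSet a b)
    (hw : ∀ i, a i x = b i → a i w ≤ 0) : ∃ ε : ℝ, 0 < ε ∧ x + ε • w ∈ solutionSet a b := by
  have : ∀ᶠ ε in 𝓝[>] (0 : ℝ), ∀ i, a i (x + ε • w) ≤ b i := by
    refine eventually_all.2 fun i => ?_
    rcases (hx i).eq_or_lt with h | h
    · filter_upwards [self_mem_nhdsWithin] with ε (hε : 0 < ε)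
      rw [map_add, map_smul, smul_eq_mul]
      nlinarith [hw i h]
    · have hc : Continuous fun ε : ℝ => a i (x + ε • w) := by fun_prop
      have := (hc.tendsto 0).mono_left (nhdsWithin_le_nhds (s := Ioi 0))
      exact (this.eventually (gt_mem_nhds (by simpa using h))).mono fun _ => le_of_lt
  obtain ⟨ε, hε, hε0⟩ := (this.and self_mem_nhdsWithin).exists
  exact ⟨ε, hε0, hε⟩

/-- A point of a face in `P^{m<B}` at which `m` attains its minimum over the union of these faces
minimizes `m` over the whole polyhedron `P`. -/
theorem le_of_forall_le_of_isExposed [Fintype ι] (m : E →L[ℝ] ℝ) {B : ℝ} {x : E} {f : Set E}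
    (hf : IsExposed ℝ (solutionSet a b) f) (hfB : ∀ p ∈ f, m p < B) (hxf : x ∈ f)
    (hmin : ∀ g, IsExposed ℝ (solutionSet a b) g → (∀ p ∈ g, m p < B) → ∀ p ∈ g, m x ≤ m p)
    {z : E} (hz : z ∈ solutionSet a b) : m x ≤ m z := by
  classical
  by_contra! hzx
  have hx := hf.subset hxf
  let S : Set E := {w | (∀ i, a i x = b i → a i w ≤ 0) ∧ m w < 0}
  let act : E → Set ι := fun w => {i | a i x = b i ∧ a i w = 0}
  have hzS : z - x ∈ S := ⟨fun i hi => by simpa [hi] using hz i, by simpa using hzx⟩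
  -- Among the feasible descent directions at `x`, take one that keeps a maximal set of active
  -- constraints sharp.
  obtain ⟨_, ⟨w, hw, rfl⟩, hmax⟩ := (toFinite (act '' S)).exists_maximal ⟨_, z - x, hzS, rfl⟩
  have hclaim : ∀ y ∈ activeFace a b (act w), m y ≤ m x := by
    intro y hy
    by_contra! hyx
    have hle : ∀ i, a i x = b i → a i (y - x) ≤ 0 := fun i hi => by simpa [hi] using hy.1 i
    -- Otherwise a small step from `x` away from `y` stays in `P`, hence in `f` by extremality, and
    -- decreases `m`.
    obtain ⟨i₁, hi₁, hi₁'⟩ : ∃ i, a i x = b i ∧ a i (y - x) < 0 := by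
      by_contra! hno
      obtain ⟨ε, hε, hεP⟩ := exists_pos_add_smul_mem_solutionSet a b (w := -(y - x)) hx
        fun i hi => by simpa using hno i hi
      have hmem : x + ε • -(y - x) ∈ f := by
        refine hf.isExtreme.left_mem_of_mem_openSegment hεP hy.1 hxf ?_
        refine ⟨1 / (1 + ε), ε / (1 + ε), by positivity, by positivity, by field_simp, ?_⟩
        match_scalars <;> grind
      have := hmin f hf hfB _ hmem
      rw [map_add, map_smul, map_neg, map_sub, smul_eq_mul] at this
      nlinarith
    -- Ratio test: the least ratio is the largest multiple of `y - x` that can be subtracted from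
    -- `w` without losing feasibility. It makes `i₀` sharp as well, against maximality.
    obtain ⟨i₀, hi₀, hs⟩ := exists_min_image {i | a i x = b i ∧ a i (y - x) < 0}
      (fun i => a i w / a i (y - x)) (toFinite _) ⟨i₁, hi₁, hi₁'⟩
    set s := a i₀ w / a i₀ (y - x) with hsdef
    have hs0 : 0 ≤ s := div_nonneg_of_nonpos (hw.1 i₀ hi₀.1) hi₀.2.le
    have hw' : w - s • (y - x) ∈ S := by
      refine ⟨fun i hi => ?_, ?_⟩
      · rw [map_sub, map_smul, smul_eq_mul]
        rcases (hle i hi).eq_or_lt with h | h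
        · rw [h, mul_zero, sub_zero]
          exact hw.1 i hi
        · have := hs i ⟨hi, h⟩
          rw [le_div_iff_of_neg h] at this
          linarith
      · rw [map_sub, map_smul, smul_eq_mul, map_sub]
        nlinarith [hw.2]
    have hsub : act w ⊆ act (w - s • (y - x)) := fun i hi => by
      refine ⟨hi.1, ?_⟩
      rw [map_sub, map_smul, map_sub, hi.2, hy.2 i hi, hi.1]
      simp
    have hi₀' : i₀ ∈ act (w - s • (y - x)) := by
      refine ⟨hi₀.1, ?_⟩
      rw [map_sub, map_smul, smul_eq_mul, hsdef, div_mul_cancel₀ _ hi₀.2.ne, sub_self]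
    have hi₀w : i₀ ∈ act w := hmax ⟨_, hw', rfl⟩ hsub hi₀'
    refine hi₀.2.ne ?_
    rw [map_sub, hy.2 i₀ hi₀w, hi₀.1, sub_self]
  -- By the claim the active face of `act w` lies below `B`, yet a step along `w` stays in it and
  -- goes below `m x`.
  obtain ⟨ε, hε, hεP⟩ := exists_pos_add_smul_mem_solutionSet a b hx hw.1
  have := hmin _ (isExposed_activeFace a b (act w))
    (fun p hp => (hclaim p hp).trans_lt (hfB x hxf)) (x + ε • w)
    ⟨hεP, fun i hi => by rw [map_add, map_smul, hi.2, hi.1]; simp⟩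
  rw [map_add, map_smul, smul_eq_mul] at this
  nlinarith [hw.2]

/-- A recession direction along which `m` does not increase is also one of the face where `m` is
minimal, and that face is bounded. -/
theorem isBounded_solutionSet_inter_of_forall_isExposed [FiniteDimensional ℝ E] [Fintype ι]
    (m : E →L[ℝ] ℝ) (B : ℝ)
    (hne : ∃ f, IsExposed ℝ (solutionSet a b) f ∧ (∀ p ∈ f, m p < B) ∧ f.Nonempty)
    (hb : ∀ f, IsExposed ℝ (solutionSet a b) f → (∀ p ∈ f, m p < B) → Bornology.IsBounded f)
    (c : ℝ) : Bornology.IsBounded (solutionSet a b ∩ {x | m x ≤ c}) := by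
  set C := {f | IsExposed ℝ (solutionSet a b) f ∧ ∀ p ∈ f, m p < B} with hC
  have hCfin : C.Finite := (hasFiniteFaces_solutionSet a b).finite.subset fun f hf => hf.1
  have hcomp : IsCompact (⋃₀ C) := hCfin.isCompact_sUnion fun f hf =>
    Metric.isCompact_of_isClosed_isBounded (hf.1.isClosed (isClosed_solutionSet a b))
      (hb f hf.1 hf.2)
  obtain ⟨f₀, hf₀, hf₀B, x₀, hx₀⟩ := hne
  obtain ⟨x, ⟨f, hf, hxf⟩, hmin⟩ :=
    hcomp.exists_isMinOn ⟨x₀, f₀, ⟨hf₀, hf₀B⟩, hx₀⟩ m.continuous.continuousOn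
  have hmin' : ∀ z ∈ solutionSet a b, m x ≤ m z := fun z hz =>
    le_of_forall_le_of_isExposed a b m hf.1 hf.2 hxf
      (fun g hg hgB p hp => hmin ⟨g, ⟨hg, hgB⟩, hp⟩) hz
  by_contra hunb
  obtain ⟨p, hp, v, hv0, hv⟩ := exists_ray_of_not_isBounded
    ((convex_solutionSet a b).inter (convex_halfSpace_le m.toLinearMap.isLinear c))
    ((isClosed_solutionSet a b).inter (isClosed_le m.continuous continuous_const)) hunb
  have hmv : m v ≤ 0 := nonpos_of_forall_add_mul_le (α := m p) (c := c) fun t ht => by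
    simpa using (hv p hp t ht).2
  have hav (i : ι) : a i v ≤ 0 :=
    nonpos_of_forall_add_mul_le (α := a i p) (c := b i) fun t ht => by
      simpa using (hv p hp t ht).1 i
  refine hv0 (eq_zero_of_forall_add_smul_mem (x := x)
    (hb _ (isExposed_of_forall_le hmin') fun p hp => ?_) fun t ht => ?_)
  · exact (show m p = m x from hp.2).trans_lt (hf.2 x hxf)
  · have hmem : x + t • v ∈ solutionSet a b := fun i => by
      rw [map_add, map_smul, smul_eq_mul]
      nlinarith [hf.1.subset hxf i, hav i]
    refine ⟨hmem, le_antisymm ?_ (hmin' _ hmem)⟩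
    rw [map_add, map_smul, smul_eq_mul]
    nlinarith

/-- A recession direction `v` of the truncation has all `a i v ≤ 0` with nonnegative sum, so all
vanish and `P` contains the line through `x` along `v`. By extremality `f` contains it too. -/
theorem isBounded_solutionSet_inter_neg_sum [FiniteDimensional ℝ E] [Fintype ι] {f : Set E}
    (hf : IsExposed ℝ (solutionSet a b) f) (hne : f.Nonempty) (hb : Bornology.IsBounded f)
    (c : ℝ) : Bornology.IsBounded (solutionSet a b ∩ {x | (-∑ i, a i : E →L[ℝ] ℝ) x ≤ c}) := by
  obtain ⟨x, hx⟩ := hne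
  by_contra hunb
  obtain ⟨p, hp, v, hv0, hv⟩ := exists_ray_of_not_isBounded
    ((convex_solutionSet a b).inter (convex_halfSpace_le
      (-∑ i, a i : E →L[ℝ] ℝ).toLinearMap.isLinear c))
    ((isClosed_solutionSet a b).inter
      (isClosed_le (-∑ i, a i : E →L[ℝ] ℝ).continuous continuous_const)) hunb
  have hmv : (-∑ i, a i : E →L[ℝ] ℝ) v ≤ 0 :=
    nonpos_of_forall_add_mul_le (α := (-∑ i, a i : E →L[ℝ] ℝ) p) (c := c) fun t ht => by
      have := (hv p hp t ht).2
      rwa [mem_ofPred_eq, map_add, map_smul, smul_eq_mul] at this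
  have hav (i : ι) : a i v ≤ 0 :=
    nonpos_of_forall_add_mul_le (α := a i p) (c := b i) fun t ht => by
      simpa using (hv p hp t ht).1 i
  rw [neg_apply, sum_apply, neg_nonpos] at hmv
  have hav0 : ∀ i, a i v = 0 := fun i =>
    (Finset.sum_eq_zero_iff_of_nonpos fun i _ => hav i).1
      (le_antisymm (Finset.sum_nonpos fun i _ => hav i) hmv) i (Finset.mem_univ i)
  have hmem (t : ℝ) : x + t • v ∈ solutionSet a b := fun i => by
    simpa [hav0] using hf.subset hx i
  refine hv0 (eq_zero_of_forall_add_smul_mem (x := x) hb fun t _ => ?_)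
  refine hf.isExtreme.left_mem_of_mem_openSegment (hmem t) (hmem (-t)) hx ?_
  refine ⟨1 / 2, 1 / 2, by norm_num, by norm_num, by norm_num, ?_⟩
  module

end SolutionSet

/-! ### Reduction of the theorem to a closed level -/

/-- Finitely many compact faces below `B` stay below some `c < B`; the closed level makes the
truncation compact. -/
theorem HasFiniteFaces.exists_forall_le_of_lt [FiniteDimensional ℝ E] {P : Set E}
    (hP : HasFiniteFaces P) (m : E →L[ℝ] ℝ) (B : ℝ)
    (hb : ∀ f, IsFace P f → (∀ p ∈ f, m p < B) → Bornology.IsBounded f) :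
    ∃ c, {f | IsFace P f ∧ ∀ p ∈ f, m p < B} = {f | IsFace P f ∧ ∀ p ∈ f, m p ≤ c} := by
  have hfin : {f | IsFace P f ∧ ∀ p ∈ f, m p < B}.Finite :=
    hP.finite.subset fun f hf => (isFace_iff_isExposed hP.convex).1 hf.1
  have hev : ∀ᶠ c in 𝓝[<] B, ∀ f ∈ {f | IsFace P f ∧ ∀ p ∈ f, m p < B}, ∀ p ∈ f, m p ≤ c := by
    refine (eventually_all_finite hfin).2 fun f hf => ?_
    rcases f.eq_empty_or_nonempty with rfl | hne
    · simp
    have hc : IsCompact f := Metric.isCompact_of_isClosed_isBounded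
      (((isFace_iff_isExposed hP.convex).1 hf.1).isClosed hP.isClosed) (hb f hf.1 hf.2)
    obtain ⟨x, hx, hmax⟩ := hc.exists_isMaxOn hne m.continuous.continuousOn
    filter_upwards [Ioo_mem_nhdsLT (hf.2 x hx)] with c hc p hp
    exact (hmax hp).trans hc.1.le
  obtain ⟨c, hc, hcB⟩ := (hev.and self_mem_nhdsWithin).exists
  refine ⟨c, Subset.antisymm (fun f hf => ⟨hf.1, hc f hf⟩)
    fun f hf => ⟨hf.1, fun p hp => (hf.2 p hp).trans_lt hcB⟩⟩

theorem HasFiniteFaces.finite_and_eulerChar_sublevelFaces_coe [FiniteDimensional ℝ E] {P : Set E}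
    (hP : HasFiniteFaces P) (ℓ : E →ᵃ[ℝ] ℝ) (B : ℝ)
    (hne : ∃ f ∈ sublevelFaces P ℓ B, f.Nonempty)
    (hbdd : ∀ f ∈ sublevelFaces P ℓ B, Bornology.IsBounded f)
    (hb : ∀ (m : E →L[ℝ] ℝ) (B' c : ℝ),
      (∃ f, IsExposed ℝ P f ∧ (∀ p ∈ f, m p < B') ∧ f.Nonempty) →
      (∀ f, IsExposed ℝ P f → (∀ p ∈ f, m p < B') → Bornology.IsBounded f) →
      Bornology.IsBounded (P ∩ {x | m x ≤ c})) :
    (sublevelFaces P ℓ B).Finite ∧ eulerChar (sublevelFaces P ℓ B) = 0 := by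
  set m : E →L[ℝ] ℝ := LinearMap.toContinuousLinearMap ℓ.linear with hm
  have hℓ (x : E) : ℓ x = m x + ℓ 0 := by
    have := congrFun ℓ.decomp x
    simpa [hm] using this
  have hC : sublevelFaces P ℓ B = {f | IsFace P f ∧ ∀ p ∈ f, m p < B - ℓ 0} := by
    ext f
    refine and_congr_right fun _ => forall₂_congr fun p _ => ?_
    rw [hℓ p, lt_sub_iff_add_lt]
  rw [hC] at hne hbdd ⊢
  obtain ⟨c, hc⟩ := hP.exists_forall_le_of_lt m _ fun f hf hfB => hbdd f ⟨hf, hfB⟩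
  obtain ⟨f, hf, x, hx⟩ := hne
  have hbc := hb m (B - ℓ 0) c ⟨f, (isFace_iff_isExposed hP.convex).1 hf.1, hf.2, x, hx⟩
    fun g hg hgB => hbdd g ⟨(isFace_iff_isExposed hP.convex).2 hg, hgB⟩
  rw [hc] at hf ⊢
  exact hP.finite_and_eulerChar_eq_zero m c
    ⟨x, ((isFace_iff_isExposed hP.convex).1 hf.1).subset hx, hf.2 x hx⟩ hbc

theorem isBounded_image_affineMap [FiniteDimensional ℝ E] (ℓ : E →ᵃ[ℝ] ℝ) {s : Set E}
    (hs : Bornology.IsBounded s) : Bornology.IsBounded (ℓ '' s) :=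
  (hs.isCompact_closure.image ℓ.continuous_of_finiteDimensional).isBounded.subset
    (image_mono subset_closure)

theorem finite_and_eulerChar_sublevelFaces_of_finite [FiniteDimensional ℝ E] {S : Set E}
    (hS : S.Finite) (ℓ : E →ᵃ[ℝ] ℝ) (B : WithTop ℝ)
    (hne : ∃ f ∈ sublevelFaces (convexHull ℝ S) ℓ B, f.Nonempty)
    (hbdd : ∀ f ∈ sublevelFaces (convexHull ℝ S) ℓ B, Bornology.IsBounded f) :
    (sublevelFaces (convexHull ℝ S) ℓ B).Finite ∧
      eulerChar (sublevelFaces (convexHull ℝ S) ℓ B) = 0 := by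
  have hP := hasFiniteFaces_convexHull hS
  have hPb : Bornology.IsBounded (convexHull ℝ S) := (hS.isCompact_convexHull ℝ).isBounded
  induction B with
  | coe B =>
    exact hP.finite_and_eulerChar_sublevelFaces_coe ℓ B hne hbdd
      fun _ _ _ _ _ => hPb.subset inter_subset_left
  | top =>
    -- Every face of a polytope counts, so the zero functional at level 0 serves.
    have hC : sublevelFaces (convexHull ℝ S) ℓ ⊤ =
        {f | IsFace (convexHull ℝ S) f ∧ ∀ p ∈ f, (0 : E →L[ℝ] ℝ) p ≤ 0} := by
      ext f
      simp only [sublevelFaces, mem_ofPred_eq, zero_apply, le_refl,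
        implies_true, and_true, and_iff_left_iff_imp]
      intro hf
      have := isBounded_image_affineMap ℓ
        (hPb.subset ((isFace_iff_isExposed hP.convex).1 hf).subset)
      exact ⟨this.bddAbove, this.bddBelow⟩
    rw [hC] at hne ⊢
    obtain ⟨f, hf, x, hx⟩ := hne
    exact hP.finite_and_eulerChar_eq_zero 0 0
      ⟨x, ((isFace_iff_isExposed hP.convex).1 hf.1).subset hx, hf.2 x hx⟩
      (hPb.subset inter_subset_left)

theorem finite_and_eulerChar_sublevelFaces_solutionSet [FiniteDimensional ℝ E] {ι : Type*}
    [Fintype ι] (a : ι → E →L[ℝ] ℝ) (b : ι → ℝ) (ℓ : E →ᵃ[ℝ] ℝ) (B : WithTop ℝ)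
    (hne : ∃ f ∈ sublevelFaces (solutionSet a b) ℓ B, f.Nonempty)
    (hbdd : ∀ f ∈ sublevelFaces (solutionSet a b) ℓ B, Bornology.IsBounded f) :
    (sublevelFaces (solutionSet a b) ℓ B).Finite ∧
      eulerChar (sublevelFaces (solutionSet a b) ℓ B) = 0 := by
  have hP := hasFiniteFaces_solutionSet a b
  induction B with
  | coe B =>
    exact hP.finite_and_eulerChar_sublevelFaces_coe ℓ B hne hbdd
      fun m B' c h₁ h₂ => isBounded_solutionSet_inter_of_forall_isExposed a b m B' h₁ h₂ c
  | top =>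
    obtain ⟨f₀, hf₀, x, hx⟩ := hne
    have hf₀e := (isFace_iff_isExposed hP.convex).1 hf₀.1
    have hm := isBounded_solutionSet_inter_neg_sum a b hf₀e ⟨x, hx⟩ (hbdd f₀ hf₀)
    set m : E →L[ℝ] ℝ := -∑ i, a i
    have hfin : (sublevelFaces (solutionSet a b) ℓ ⊤).Finite :=
      hP.finite.subset fun f hf => (isFace_iff_isExposed hP.convex).1 hf.1
    have hev : ∀ᶠ c in atTop, ∀ f ∈ sublevelFaces (solutionSet a b) ℓ ⊤, ∀ p ∈ f, m p ≤ c := by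
      refine (eventually_all_finite hfin).2 fun f hf => ?_
      obtain ⟨M, hM⟩ := (isBounded_image_affineMap m.toLinearMap.toAffineMap (hbdd f hf)).bddAbove
      filter_upwards [eventually_ge_atTop M] with c hc p hp
      exact (hM (mem_image_of_mem _ hp)).trans hc
    obtain ⟨c, hc⟩ := hev.exists
    -- Conversely, a face on which `m ≤ c` lies in a bounded truncation, so `ℓ` is bounded on it.
    have hC : sublevelFaces (solutionSet a b) ℓ ⊤ =
        {f | IsFace (solutionSet a b) f ∧ ∀ p ∈ f, m p ≤ c} := by
      refine Subset.antisymm (fun f hf => ⟨hf.1, hc f hf⟩) fun f hf => ?_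
      have := isBounded_image_affineMap ℓ ((hm c).subset fun p hp =>
        ⟨((isFace_iff_isExposed hP.convex).1 hf.1).subset hp, hf.2 p hp⟩)
      exact ⟨hf.1, this.bddAbove, this.bddBelow⟩
    rw [hC]
    exact hP.finite_and_eulerChar_eq_zero m c ⟨x, hf₀e.subset hx, hc f₀ hf₀ x hx⟩ (hm c)

end PolyEuler

theorem mainTheorem2 (D : ℕ) (P : Set (EuclideanSpace ℝ (Fin D)))
    (hP : PolyEuler.IsPolytope P ∨ PolyEuler.IsPolyhedron P)
    (ℓ : EuclideanSpace ℝ (Fin D) →ᵃ[ℝ] ℝ) (B : WithTop ℝ)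
    (hne : ∃ f ∈ PolyEuler.sublevelFaces P ℓ B, f.Nonempty)
    (hbdd : ∀ f ∈ PolyEuler.sublevelFaces P ℓ B, Bornology.IsBounded f) :
    (PolyEuler.sublevelFaces P ℓ B).Finite ∧
      PolyEuler.eulerChar (PolyEuler.sublevelFaces P ℓ B) = 0 := by
  rcases hP with ⟨S, hS, rfl⟩ | hP
  · exact PolyEuler.finite_and_eulerChar_sublevelFaces_of_finite hS ℓ B hne hbdd
  · obtain ⟨ι, _, a, b, rfl⟩ := hP.exists_eq_solutionSet
    exact PolyEuler.finite_and_eulerChar_sublevelFaces_solutionSet a b ℓ B hne hbdd
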